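/- Let $q$ be a prime power and let $k\ge 4$ and $n\ge 2k+2$ be integers. For subspaces $X,Y$ of $\mathbb F_q^n$ let $d_I(X,Y)=\max\{\dim X,\dim Y\}-\dim(X\cap Y)$ be the injection distance, and let $A_q(n,2,k)$ be the maximum size of a set $\mathbb C$ of $k$-dimensional subspaces of $\mathbb F_q^n$ with $\min\{d_I(X,Y) : X,Y\in\mathbb C,\ X\ne Y\}=2$. Then \[ A_q(n,2,k)\;\ge\;\sum_{i=1}^{\lfloor (n-2)/k\rfloor-1}\left(q^{(k-1)(n-ik)}+\frac{(q^{2(k-2)}-1)(q^{2(n-ik-1)}-1)}{(q^4-1)^2}\,q^{(k-3)(n-ik-2)+4}\right). \] -/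

import Mathlib

namespace GrassmannCode

/-- The injection distance `max {dim X, dim Y} - dim (X ∩ Y)` of two subspaces of `F^n`.
The subtraction never truncates, since `X ∩ Y` is contained in both `X` and `Y`. -/
noncomputable def injectionDist {F : Type*} [Field F] {n : ℕ}
    (X Y : Submodule F (Fin n → F)) : ℕ :=
  max (Module.finrank F X) (Module.finrank F Y) - Module.finrank F ↥(X ⊓ Y)

/-- `C` is an `(n, M, d, k)` constant-dimension code over `F`: it consists of `M` subspaces of
`F^n`, all of dimension `k`, and the minimum of the injection distances of two distinct
codewords (which is attained) equals `d`. -/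
structure IsConstDimCode {F : Type*} [Field F] (n M d k : ℕ)
    (C : Set (Submodule F (Fin n → F))) : Prop where
  dim_eq : ∀ X ∈ C, Module.finrank F X = k
  card_eq : C.ncard = M
  minDist : IsLeast {δ : ℕ | ∃ X ∈ C, ∃ Y ∈ C, X ≠ Y ∧ injectionDist X Y = δ} d

/-- `A_q(n, d, k)` for the finite field `F` with `q` elements: the maximum `M` for which an
`(n, M, d, k)` constant-dimension code over `F` exists. -/
noncomputable def maxCodeSize (F : Type*) [Field F] (n d k : ℕ) : ℕ :=
  sSup {M : ℕ | ∃ C : Set (Submodule F (Fin n → F)), IsConstDimCode n M d k C}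

/-- Over a finite field the code sizes are bounded, so the supremum above is a maximum as soon
as some code with the given parameters exists. -/
theorem bddAbove_codeSizes (F : Type*) [Field F] [Finite F] (n d k : ℕ) :
    BddAbove {M : ℕ | ∃ C : Set (Submodule F (Fin n → F)), IsConstDimCode n M d k C} := by
  have hfin : Finite (Submodule F (Fin n → F)) :=
    Finite.of_injective (fun X : Submodule F (Fin n → F) => (X : Set (Fin n → F)))
      SetLike.coe_injective
  refine ⟨Nat.card (Submodule F (Fin n → F)), ?_⟩
  rintro M ⟨C, hC⟩
  rw [← hC.card_eq]
  exact Set.ncard_le_card C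

end GrassmannCode

/-!
The code is a multilevel construction. Fix a set `P` of `k` pivot columns. The echelon forms with
pivot set `P` have free entries at the *dots*, the nonpivot positions to the right of the pivot of
their row (`cellSpace`, `dots`). Two facts control the intersections of their row spaces.

* Two spaces with pivot sets `P` and `R` meet in dimension at most `|P ∩ R|`, since the first
  nonzero position of a common vector is a pivot of both (`finrank_cellSpace_inf_le`). So different
  pivot sets do not interfere as long as they share at most `k - 2` elements.
* Two spaces with the same pivot set meet in dimension at least `k - 1` only if their matrices
  differ by a matrix of rank at most one (`exists_rank_one_of_le_finrank_inf`). Such differences are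
  excluded by a syndrome with values in the extension field of degree `m`, where `m ≥ k` bounds the
  number of columns that contain dots: on the matrix `u p * v c` it is the product
  `(∑ u p • e p) * (∑ v c • g c)`, with families `e`, `g` linearly independent over `F`. Its kernel
  has codimension at most `m` (`exists_cellCode`), so `P` contributes at least `q ^ (D - m)`
  codewords, where `D` is the number of dots.

For each `i` in the sum let `m = n - i * k`. The pivot sets used are the `i`-th block of `k`
consecutive columns, with `D = k * m`, and the sets obtained from it by trading a pair of
neighbouring columns, number `j` from the end of the block, for the pair number `l` to the right of
the block, with `D = k * m - 4 - 4 * j - 4 * l`. The pairs are disjoint, so these sets pairwise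
share at most `k - 2` elements; sets of different blocks share at most two, and `k ≥ 4`. Summing the
two geometric series over `j < k / 2` and `l < m / 2` gives at least the second summand of the
formula (`formula_le_sum_pivotIndices`).

Every kernel contains the zero matrix, so two coordinate subspaces whose pivot sets share exactly
`k - 2` elements are codewords, and the minimum distance two is attained.
-/

namespace GrassmannCode

open Module

/-! ### Subspaces in echelon form -/

/-- The subspace of `F^ι` with information positions `P` and parity entries `M`: a vector is
arbitrary on `P`, and its entry at each `c ∉ P` is `∑ p ∈ P, v p * M p c`. It is the row space of
the matrix which is the identity on the columns in `P` and `M` on the others; only the entries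
`M p c` with `p ∈ P` and `c ∉ P` matter. -/
def cellSpace {F ι : Type*} [Field F] (P : Finset ι) (M : ι → ι → F) : Submodule F (ι → F) where
  carrier := {v | ∀ c ∉ P, v c = ∑ p ∈ P, v p * M p c}
  add_mem' {v w} hv hw c hc := by
    simp only [Pi.add_apply, hv c hc, hw c hc, add_mul, Finset.sum_add_distrib]
  zero_mem' c _ := by simp
  smul_mem' a v hv c hc := by
    simp only [Pi.smul_apply, smul_eq_mul, hv c hc, Finset.mul_sum, mul_assoc]

section Echelon

variable {F ι : Type*} [Field F]

theorem finrank_cellSpace (P : Finset ι) (M : ι → ι → F) :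
    finrank F (cellSpace P M) = P.card := by
  classical
  let f : cellSpace P M →ₗ[F] (P → F) :=
    { toFun := fun v p => v.1 p
      map_add' := fun _ _ => rfl
      map_smul' := fun _ _ => rfl }
  have hf : Function.Bijective f := by
    constructor
    · intro v w h
      have h' : ∀ p ∈ P, v.1 p = w.1 p := fun p hp => congrFun h ⟨p, hp⟩
      ext c
      by_cases hc : c ∈ P
      · exact h' c hc
      · rw [v.2 c hc, w.2 c hc]
        exact Finset.sum_congr rfl fun p hp => by rw [h' p hp]
    · intro u
      let u' : ι → F := fun p => if h : p ∈ P then u ⟨p, h⟩ else 0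
      refine ⟨⟨fun c => if c ∈ P then u' c else ∑ p ∈ P, u' p * M p c, ?_⟩, ?_⟩
      · intro c hc
        simp only [if_neg hc]
        exact Finset.sum_congr rfl fun p hp => by rw [if_pos hp]
      · ext p
        simp [f, u']
  rw [(LinearEquiv.ofBijective f hf).finrank_eq]
  simp

theorem cellSpace_zero_le [DecidableEq ι] {P R : Finset ι} (h : P ⊆ R) :
    cellSpace P (0 : ι → ι → F) ≤ cellSpace R 0 := by
  intro v hv c hc
  simpa using hv c (fun hP => hc (h hP))

/-- If both parity parts are strictly upper triangular, the first nonzero position of a vector in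
the intersection lies in `P` and in `R`. -/
theorem finrank_cellSpace_inf_le [LinearOrder ι] [Fintype ι] {P R : Finset ι} {M N : ι → ι → F}
    (hM : ∀ p c, ¬ p < c → M p c = 0) (hN : ∀ p c, ¬ p < c → N p c = 0) :
    finrank F ↥(cellSpace P M ⊓ cellSpace R N) ≤ (P ∩ R).card := by
  let f : ↥(cellSpace P M ⊓ cellSpace R N) →ₗ[F] (↥(P ∩ R) → F) :=
    { toFun := fun v p => v.1 p
      map_add' := fun _ _ => rfl
      map_smul' := fun _ _ => rfl }
  have hf : Function.Injective f := by
    rw [← LinearMap.ker_eq_bot, LinearMap.ker_eq_bot']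
    rintro ⟨v, hvM, hvN⟩ hv
    have hv' : ∀ p ∈ P ∩ R, v p = 0 := fun p hp => congrFun hv ⟨p, hp⟩
    have key : ∀ c, v c = 0 := by
      intro c
      induction c using WellFoundedLT.induction with
      | ind c ih =>
        have aux : ∀ (S : Finset ι) (L : ι → ι → F), (∀ p c, ¬ p < c → L p c = 0) →
            v ∈ cellSpace S L → c ∉ S → v c = 0 := by
          intro S L hL hvL hc
          rw [hvL c hc]
          refine Finset.sum_eq_zero fun p _ => ?_
          by_cases hpc : p < c
          · rw [ih p hpc, zero_mul]
          · rw [hL p c hpc, mul_zero]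
        by_cases hP : c ∈ P
        · by_cases hR : c ∈ R
          · exact hv' c (Finset.mem_inter.2 ⟨hP, hR⟩)
          · exact aux R N hN hvN hR
        · exact aux P M hM hvM hP
    exact Subtype.ext (funext key)
  have h := LinearMap.finrank_le_finrank_of_injective hf
  rwa [finrank_fintype_fun_eq_card, Fintype.card_coe] at h

/-- The intersection of two subspaces with the same information positions is the left kernel of
the difference of their parity parts, so a large intersection makes this difference have rank at
most one. -/
theorem exists_rank_one_of_le_finrank_inf [Fintype ι] {P : Finset ι} {M N : ι → ι → F}
    (h : P.card ≤ finrank F ↥(cellSpace P M ⊓ cellSpace P N) + 1) :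
    ∃ u v : ι → F, ∀ p ∈ P, ∀ c ∉ P, M p c - N p c = u p * v c := by
  classical
  let T : (P → F) →ₗ[F] (↥(Finset.univ \ P) → F) :=
    { toFun := fun u c => ∑ p, u p * (M p c - N p c)
      map_add' := fun _ _ => by
        ext; simp only [Pi.add_apply, add_mul, Finset.sum_add_distrib]
      map_smul' := fun _ _ => by
        ext; simp [Finset.mul_sum, mul_assoc] }
  let f : ↥(cellSpace P M ⊓ cellSpace P N) →ₗ[F] LinearMap.ker T :=
    { toFun := fun v => ⟨fun p => v.1 p, by
        rw [LinearMap.mem_ker]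
        ext c
        have hc : c.1 ∉ P := (Finset.mem_sdiff.1 c.2).2
        have h1 := v.2.1 c hc
        have h2 := v.2.2 c hc
        have h3 : ∑ p : P, v.1 p * (M p c - N p c) = ∑ p ∈ P, v.1 p * (M p c - N p c) :=
          Finset.sum_coe_sort P (fun p => v.1 p * (M p c - N p c))
        change ∑ p : P, v.1 p * (M p c - N p c) = 0
        rw [h3]
        simp only [mul_sub, Finset.sum_sub_distrib]
        rw [← h1, ← h2, sub_self]⟩
      map_add' := fun _ _ => rfl
      map_smul' := fun _ _ => rfl }
  have hf : Function.Injective f := by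
    intro v w hvw
    have h' : ∀ p ∈ P, v.1 p = w.1 p := fun p hp => congrFun (congrArg Subtype.val hvw) ⟨p, hp⟩
    ext c
    by_cases hc : c ∈ P
    · exact h' c hc
    · rw [v.2.1 c hc, w.2.1 c hc]
      exact Finset.sum_congr rfl fun p hp => by rw [h' p hp]
  have h1 := LinearMap.finrank_le_finrank_of_injective hf
  have h2 := LinearMap.finrank_range_add_finrank_ker T
  have h3 : finrank F (P → F) = P.card := by simp
  have h4 : finrank F (LinearMap.range T) ≤ 1 := by omega
  obtain ⟨v, hv⟩ := finrank_le_one_iff.1 h4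
  choose a ha using fun p : P => hv ⟨T (Pi.single p 1), LinearMap.mem_range_self T _⟩
  refine ⟨fun p => if hp : p ∈ P then a ⟨p, hp⟩ else 0,
    fun c => if hc : c ∈ Finset.univ \ P then v.1 ⟨c, hc⟩ else 0, fun p hp c hc => ?_⟩
  have hc' : c ∈ Finset.univ \ P := by simp [hc]
  have := congrFun (congrArg Subtype.val (ha ⟨p, hp⟩)) ⟨c, hc'⟩
  simp only [dif_pos hp, dif_pos hc']
  rw [Submodule.coe_smul, Pi.smul_apply, smul_eq_mul] at this
  simpa [T, Pi.single_apply] using this.symm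

end Echelon

/-! ### Rank-metric codes on Ferrers diagrams -/

section Ferrers

variable {ι : Type*} [LinearOrder ι]

/-- The positions of `P ×ˢ Q` in which the parity part of an echelon form with pivot set `P` may be
nonzero: those lying strictly to the right of the pivot of their row. -/
def dots (P Q : Finset ι) : Finset (ι × ι) := (P ×ˢ Q).filter fun x => x.1 < x.2

theorem mem_dots {P Q : Finset ι} {x : ι × ι} :
    x ∈ dots P Q ↔ (x.1 ∈ P ∧ x.2 ∈ Q) ∧ x.1 < x.2 := by
  simp [dots]

variable {F : Type*} [Field F]

/-- The matrix with the given entries at the dots and zeros elsewhere. -/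
def extendDots {P Q : Finset ι} (M : dots P Q → F) (p c : ι) : F :=
  if h : (p, c) ∈ dots P Q then M ⟨(p, c), h⟩ else 0

theorem extendDots_of_not_lt {P Q : Finset ι} (M : dots P Q → F) (p c : ι) (h : ¬ p < c) :
    extendDots M p c = 0 :=
  dif_neg fun hd => h (mem_dots.1 hd).2

theorem extendDots_zero {P Q : Finset ι} : extendDots (0 : dots P Q → F) = 0 := by
  funext p c
  simp [extendDots]

/-- The syndrome `∑ M p c • (e p * g c)` of a matrix on the dots, with values in an extension
field. The syndrome of a rank one matrix `u p * v c` is the product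
`(∑ u p • e p) * (∑ v c • g c)`. -/
def syndrome {K : Type*} [Field K] [Algebra F K] (P Q : Finset ι) (e g : ι → K) :
    (dots P Q → F) →ₗ[F] K :=
  Fintype.linearCombination F fun x : dots P Q => e x.1.1 * g x.1.2

theorem syndrome_apply {K : Type*} [Field K] [Algebra F K] {P Q : Finset ι} {e g : ι → K}
    (M : dots P Q → F) :
    syndrome P Q e g M = ∑ p ∈ P, ∑ c ∈ Q, extendDots M p c • (e p * g c) := by
  rw [← Finset.sum_product', syndrome, Fintype.linearCombination_apply]
  have h : ∀ x : dots P Q, M x • (e x.1.1 * g x.1.2) =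
      extendDots M x.1.1 x.1.2 • (e x.1.1 * g x.1.2) := by
    intro x
    rw [extendDots, dif_pos x.2]
  rw [Finset.sum_congr rfl fun x _ => h x,
    Finset.sum_coe_sort (dots P Q) fun x => extendDots M x.1 x.2 • (e x.1 * g x.2)]
  refine Finset.sum_subset (Finset.filter_subset _ _) fun x _ hx => ?_
  rw [extendDots, dif_neg hx, zero_smul]

/-- The code of matrices with syndrome zero contains no matrix of rank one. -/
theorem eq_zero_of_syndrome_eq_zero {K : Type*} [Field K] [Algebra F K] {P Q : Finset ι}
    {e g : ι → K} (he : LinearIndepOn F e (P : Set ι)) (hg : LinearIndepOn F g (Q : Set ι))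
    {M : dots P Q → F} (hM : syndrome P Q e g M = 0) {u v : ι → F}
    (huv : ∀ p ∈ P, ∀ c ∈ Q, extendDots M p c = u p * v c) : M = 0 := by
  have hprod : (∑ p ∈ P, u p • e p) * (∑ c ∈ Q, v c • g c) = 0 := by
    rw [← hM, syndrome_apply, Finset.sum_mul_sum]
    refine Finset.sum_congr rfl fun p hp => Finset.sum_congr rfl fun c hc => ?_
    rw [huv p hp c hc, smul_mul_smul_comm]
  have hzero : ∀ p ∈ P, ∀ c ∈ Q, extendDots M p c = 0 := by
    intro p hp c hc
    rw [huv p hp c hc]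
    rcases mul_eq_zero.1 hprod with h | h
    · rw [linearIndepOn_finset_iff.1 he u h p hp, zero_mul]
    · rw [linearIndepOn_finset_iff.1 hg v h c hc, mul_zero]
  funext x
  have hx := mem_dots.1 x.2
  have := hzero x.1.1 hx.1.1 x.1.2 hx.1.2
  rwa [extendDots, dif_pos x.2] at this

end Ferrers

theorem exists_linearIndepOn {F K ι : Type*} [Field F] [AddCommGroup K] [Module F K]
    [FiniteDimensional F K] {P : Finset ι} (hP : P.card ≤ finrank F K) :
    ∃ e : ι → K, LinearIndepOn F e (P : Set ι) := by
  classical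
  let φ : P → Fin (finrank F K) := fun p => Fin.castLE hP (P.equivFin p)
  have hφ : Function.Injective φ := fun a b h => P.equivFin.injective (Fin.castLE_injective hP h)
  refine ⟨fun p => if h : p ∈ P then finBasis F K (φ ⟨p, h⟩) else 0, ?_⟩
  have := (finBasis F K).linearIndependent.comp φ hφ
  have hcomp : (fun p : P => if h : p.1 ∈ P then finBasis F K (φ ⟨p, h⟩) else 0) =
      finBasis F K ∘ φ := funext fun p => dif_pos p.2
  rw [← hcomp] at this
  exact this

theorem exists_field_finrank_eq (F : Type*) [Field F] [Finite F] {m : ℕ} (hm : m ≠ 0) :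
    ∃ (K : Type) (_ : Field K) (_ : Algebra F K), FiniteDimensional F K ∧ finrank F K = m := by
  obtain ⟨p, hp⟩ := CharP.exists F
  have := hp
  have : NeZero m := ⟨hm⟩
  have : Fact p.Prime := ⟨CharP.char_is_prime F p⟩
  exact ⟨FiniteField.Extension F p m, inferInstance, inferInstance, inferInstance,
    FiniteField.finrank_extension F p m⟩

/-- The codewords with pivot set `P` are the echelon forms whose parity part has syndrome zero.
The syndrome takes values in the extension field of degree `m`, which costs at most `m`
dimensions, and it is nonzero on matrices of rank one. -/
theorem exists_cellCode {F ι : Type*} [Field F] [Fintype F] [LinearOrder ι] [Fintype ι] {m : ℕ}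
    (hm : m ≠ 0) {P Q : Finset ι} (hPQ : Disjoint P Q) (hP : P.card ≤ m) (hQ : Q.card ≤ m) :
    ∃ C : Finset (Submodule F (ι → F)),
      (∀ X ∈ C, ∃ M : ι → ι → F, (∀ p c, ¬ p < c → M p c = 0) ∧ X = cellSpace P M) ∧
      cellSpace P 0 ∈ C ∧
      (∀ X ∈ C, ∀ Y ∈ C, X ≠ Y → finrank F ↥(X ⊓ Y) + 2 ≤ P.card) ∧
      Fintype.card F ^ (dots P Q).card ≤ C.card * Fintype.card F ^ m := by
  classical
  obtain ⟨K, _, _, _, hK⟩ := exists_field_finrank_eq F hm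
  obtain ⟨e, he⟩ := exists_linearIndepOn (F := F) (K := K) (P := P) (by omega)
  obtain ⟨g, hg⟩ := exists_linearIndepOn (F := F) (K := K) (P := Q) (by omega)
  let S := syndrome (F := F) P Q e g
  have hdist : ∀ M ∈ LinearMap.ker S, ∀ N ∈ LinearMap.ker S,
      P.card ≤ finrank F ↥(cellSpace P (extendDots M) ⊓ cellSpace P (extendDots N)) + 1 →
      M = N := by
    intro M hM N hN h
    obtain ⟨u, v, huv⟩ := exists_rank_one_of_le_finrank_inf h
    refine sub_eq_zero.1 (eq_zero_of_syndrome_eq_zero he hg (u := u) (v := v)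
      (LinearMap.mem_ker.1 (Submodule.sub_mem _ hM hN)) fun p hp c hc => ?_)
    rw [← huv p hp c (Finset.disjoint_right.1 hPQ hc)]
    by_cases hd : (p, c) ∈ dots P Q <;> simp [extendDots, hd]
  have hinj : Function.Injective fun M : LinearMap.ker S => cellSpace P (extendDots M.1) := by
    intro M N hMN
    refine Subtype.ext (hdist M.1 M.2 N.1 N.2 ?_)
    have h : cellSpace P (extendDots M.1) = cellSpace P (extendDots N.1) := hMN
    rw [h, inf_idem, finrank_cellSpace]
    omega
  refine ⟨Finset.univ.image fun M : LinearMap.ker S => cellSpace P (extendDots M.1),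
    ?_, ?_, ?_, ?_⟩
  · intro X hX
    obtain ⟨M, -, rfl⟩ := Finset.mem_image.1 hX
    exact ⟨_, extendDots_of_not_lt M.1, rfl⟩
  · refine Finset.mem_image.2 ⟨0, Finset.mem_univ _, ?_⟩
    simp [extendDots_zero]
  · intro X hX Y hY hXY
    obtain ⟨M, -, rfl⟩ := Finset.mem_image.1 hX
    obtain ⟨N, -, rfl⟩ := Finset.mem_image.1 hY
    by_contra h
    exact hXY (by rw [hdist M.1 M.2 N.1 N.2 (by omega)])
  · rw [Finset.card_image_of_injective _ hinj, Finset.card_univ,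
      card_eq_pow_finrank (K := F) (V := LinearMap.ker S), ← pow_add]
    refine Nat.pow_le_pow_right Fintype.card_pos ?_
    have h1 := LinearMap.finrank_range_add_finrank_ker S
    have h2 := Submodule.finrank_le (LinearMap.range S)
    have h3 : finrank F (dots P Q → F) = (dots P Q).card := by simp
    omega

/-! ### Multilevel codes -/

/-- The union of the codes of several pivot sets is a code as soon as any two of the pivot sets
share at most `k - 2` elements. The distance two is attained by the coordinate subspaces of two
pivot sets that share exactly `k - 2` elements. -/
theorem exists_multilevelCode {F τ : Type*} [Field F] [Fintype F] {n k : ℕ} (T : Finset τ)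
    (P Q : τ → Finset (Fin n)) (m : τ → ℕ) (hPQ : ∀ t ∈ T, Disjoint (P t) (Q t))
    (hk : 2 ≤ k) (hP : ∀ t ∈ T, (P t).card = k) (hkm : ∀ t ∈ T, k ≤ m t)
    (hQ : ∀ t ∈ T, (Q t).card ≤ m t)
    (hT : ∀ s ∈ T, ∀ t ∈ T, s ≠ t → (P s ∩ P t).card + 2 ≤ k)
    (hmin : ∃ s ∈ T, ∃ t ∈ T, (P s ∩ P t).card + 2 = k) :
    ∑ t ∈ T, (Fintype.card F : ℝ) ^ (dots (P t) (Q t)).card / (Fintype.card F : ℝ) ^ m t ≤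
      (maxCodeSize F n 2 k : ℝ) := by
  classical
  have hex : ∀ t : T, _ := fun t => exists_cellCode (F := F) (m := m t)
    (by have := hkm t t.2; omega) (hPQ t t.2) ((hP t t.2).trans_le (hkm t t.2)) (hQ t t.2)
  choose C hCM hC0 hCd hCc using hex
  have hdim : ∀ t, ∀ X ∈ C t, finrank F X = k := by
    intro t X hX
    obtain ⟨M, -, rfl⟩ := hCM t X hX
    rw [finrank_cellSpace, hP t t.2]
  have hcross : ∀ s t, s ≠ t → ∀ X ∈ C s, ∀ Y ∈ C t, finrank F ↥(X ⊓ Y) + 2 ≤ k := by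
    intro s t hst X hX Y hY
    obtain ⟨M, hM, rfl⟩ := hCM s X hX
    obtain ⟨N, hN, rfl⟩ := hCM t Y hY
    have h1 := finrank_cellSpace_inf_le (P := P s) (R := P t) hM hN
    have h2 := hT s s.2 t t.2 (fun h => hst (Subtype.ext h))
    omega
  have hdist : ∀ s t, ∀ X ∈ C s, ∀ Y ∈ C t, X ≠ Y → finrank F ↥(X ⊓ Y) + 2 ≤ k := by
    intro s t X hX Y hY hXY
    by_cases hst : s = t
    · subst hst
      exact (hCd s X hX Y hY hXY).trans_eq (hP s s.2)
    · exact hcross s t hst X hX Y hY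
  let U := (Finset.univ : Finset T).biUnion C
  have hU : U.card = ∑ t, (C t).card := by
    refine Finset.card_biUnion fun s _ t _ hst => Finset.disjoint_left.2 fun X hX hX' => ?_
    have h1 := hcross s t hst X hX X hX'
    rw [inf_idem, hdim s X hX] at h1
    omega
  have hcode : IsConstDimCode n U.card 2 k (U : Set (Submodule F (Fin n → F))) := by
    refine ⟨?_, Set.ncard_coe_finset U, ?_, ?_⟩
    · intro X hX
      obtain ⟨t, -, hXt⟩ := Finset.mem_biUnion.1 hX
      exact hdim t X hXt
    · obtain ⟨s, hs, t, ht, hst⟩ := hmin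
      have hXs := hC0 ⟨s, hs⟩
      have hXt := hC0 ⟨t, ht⟩
      have hne : s ≠ t := by
        rintro rfl
        rw [Finset.inter_self, hP s hs] at hst
        omega
      have hle := hcross ⟨s, hs⟩ ⟨t, ht⟩ (fun h => hne (congrArg Subtype.val h)) _ hXs _ hXt
      refine ⟨_, Finset.mem_biUnion.2 ⟨_, Finset.mem_univ _, hXs⟩,
        _, Finset.mem_biUnion.2 ⟨_, Finset.mem_univ _, hXt⟩, ?_, ?_⟩
      · intro h
        rw [← h, inf_idem, hdim _ _ hXs] at hle
        omega
      · have hge := Submodule.finrank_mono (le_inf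
          (cellSpace_zero_le (F := F) (Finset.inter_subset_left (s₁ := P s) (s₂ := P t)))
          (cellSpace_zero_le (F := F) (Finset.inter_subset_right (s₁ := P s) (s₂ := P t))))
        rw [finrank_cellSpace] at hge
        rw [injectionDist, hdim _ _ hXs, hdim _ _ hXt, max_self]
        simp only at hle ⊢
        omega
    · rintro δ ⟨X, hX, Y, hY, hXY, rfl⟩
      obtain ⟨s, -, hXs⟩ := Finset.mem_biUnion.1 hX
      obtain ⟨t, -, hYt⟩ := Finset.mem_biUnion.1 hY
      have := hdist s t X hXs Y hYt hXY
      rw [injectionDist, hdim s X hXs, hdim t Y hYt, max_self]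
      omega
  have hle : U.card ≤ maxCodeSize F n 2 k := le_csSup (bddAbove_codeSizes F n 2 k) ⟨_, hcode⟩
  have hq : (0 : ℝ) < Fintype.card F := by exact_mod_cast Fintype.card_pos
  calc _ = ∑ t : T, (Fintype.card F : ℝ) ^ (dots (P t) (Q t)).card /
        (Fintype.card F : ℝ) ^ m t :=
        (Finset.sum_coe_sort T fun t => (Fintype.card F : ℝ) ^ (dots (P t) (Q t)).card /
          (Fintype.card F : ℝ) ^ m t).symm
    _ ≤ ∑ t : T, ((C t).card : ℝ) := by
        refine Finset.sum_le_sum fun t _ => ?_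
        rw [div_le_iff₀ (pow_pos hq _)]
        exact_mod_cast hCc t
    _ = (U.card : ℝ) := by rw [hU]; push_cast; rfl
    _ ≤ _ := by exact_mod_cast hle

/-! ### Pivot sets and the number of their dots -/

theorem two_mul_card_dots_self {ι : Type*} [LinearOrder ι] (P : Finset ι) :
    2 * (dots P P).card + P.card = P.card * P.card := by
  have hswap : (P.offDiag.filter fun x => ¬ x.1 < x.2).card = (dots P P).card := by
    refine Finset.card_bij' (fun x _ => x.swap) (fun x _ => x.swap) ?_ ?_ (fun _ _ => rfl)
      (fun _ _ => rfl)
    · rintro ⟨a, b⟩ h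
      simp only [Finset.mem_filter, Finset.mem_offDiag, not_lt] at h
      exact mem_dots.2 ⟨⟨h.1.2.1, h.1.1⟩, lt_of_le_of_ne h.2 (Ne.symm h.1.2.2)⟩
    · rintro ⟨a, b⟩ h
      have h := mem_dots.1 h
      simp only [Finset.mem_filter, Finset.mem_offDiag, not_lt, Prod.fst_swap, Prod.snd_swap]
      exact ⟨⟨h.1.2, h.1.1, h.2.ne'⟩, h.2.le⟩
  have hid : (P.offDiag.filter fun x => x.1 < x.2) = dots P P := by
    ext x
    simp only [Finset.mem_filter, Finset.mem_offDiag, mem_dots]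
    exact ⟨fun h => ⟨⟨h.1.1, h.1.2.1⟩, h.2⟩, fun h => ⟨⟨h.1.1, h.1.2, h.2.ne⟩, h.2⟩⟩
  have h1 := Finset.card_filter_add_card_filter_not (s := P.offDiag) fun x => x.1 < x.2
  rw [hid, hswap, Finset.offDiag_card] at h1
  have h2 := Nat.le_mul_self P.card
  omega

/-- Row `p` has `n - 1 - p` positions to the right of its pivot; the positions lying below a later
pivot have to be discarded. -/
theorem card_dots_add {n : ℕ} {P Q : Finset (Fin n)} (hPQ : Disjoint P Q)
    (hQ : ∀ p ∈ P, ∀ c, p < c → c ∉ P → c ∈ Q) :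
    (dots P Q).card + (dots P P).card + ∑ p ∈ P, ((p : ℕ) + 1) = P.card * n := by
  have hunion : dots P Q ∪ dots P P = dots P Finset.univ := by
    ext x
    simp only [Finset.mem_union, mem_dots, Finset.mem_univ, and_true]
    constructor
    · rintro (h | h)
      · exact ⟨h.1.1, h.2⟩
      · exact ⟨h.1.1, h.2⟩
    · rintro ⟨h1, h2⟩
      by_cases hx : x.2 ∈ P
      · exact Or.inr ⟨⟨h1, hx⟩, h2⟩
      · exact Or.inl ⟨⟨h1, hQ _ h1 _ h2 hx⟩, h2⟩
  have hdisj : Disjoint (dots P Q) (dots P P) := Finset.disjoint_left.2 fun x hx hx' =>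
    Finset.disjoint_left.1 hPQ (mem_dots.1 hx').1.2 (mem_dots.1 hx).1.2
  have hrow : (dots P Finset.univ).card = ∑ p ∈ P, (n - 1 - (p : ℕ)) := by
    rw [dots, Finset.card_filter, Finset.sum_product]
    refine Finset.sum_congr rfl fun p _ => ?_
    rw [← Finset.card_filter, ← Fin.card_Ioi]
    congr 1
    ext c
    simp
  rw [← Finset.card_union_of_disjoint hdisj, hunion, hrow, ← Finset.sum_add_distrib,
    ← smul_eq_mul, ← Finset.sum_const]
  exact Finset.sum_congr rfl fun p _ => by omega

/-- The pivot sets of the construction in the block `[a, a + k)`: the block itself, and for each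
pair `(j, l)` the block with its last but `j` pair of positions replaced by the pair number `l`
to the right of the block. The subtractions do not truncate when `2 * j + 2 ≤ k`. Counting the pairs
`j` from the end of the block keeps the number of dots largest, also when `k` is odd. -/
def pivots (a k : ℕ) : Option (ℕ × ℕ) → Finset ℕ
  | none => Finset.Ico a (a + k)
  | some x => insert (a + k + 2 * x.2) (insert (a + k + 2 * x.2 + 1)
      (Finset.Ico a (a + k) \ {a + k - 2 - 2 * x.1, a + k - 1 - 2 * x.1}))

theorem mem_pivots_none {a k c : ℕ} : c ∈ pivots a k none ↔ a ≤ c ∧ c < a + k := by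
  simp [pivots]

theorem mem_pivots_some {a k j l c : ℕ} : c ∈ pivots a k (some (j, l)) ↔
    c = a + k + 2 * l ∨ c = a + k + 2 * l + 1 ∨
      ((a ≤ c ∧ c < a + k) ∧ c ≠ a + k - 2 - 2 * j ∧ c ≠ a + k - 1 - 2 * j) := by
  simp [pivots]

theorem sum_pivots_some {a k j l : ℕ} (hj : 2 * j + 2 ≤ k) (f : ℕ → ℕ) :
    ∑ p ∈ pivots a k (some (j, l)), f p + (f (a + k - 2 - 2 * j) + f (a + k - 1 - 2 * j)) =
      ∑ p ∈ Finset.Ico a (a + k), f p + (f (a + k + 2 * l) + f (a + k + 2 * l + 1)) := by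
  have hsub : ({a + k - 2 - 2 * j, a + k - 1 - 2 * j} : Finset ℕ) ⊆ Finset.Ico a (a + k) := by
    intro c hc
    simp only [Finset.mem_insert, Finset.mem_singleton] at hc
    rw [Finset.mem_Ico]
    omega
  have h1 := Finset.sum_sdiff (f := f) hsub
  rw [Finset.sum_pair (by omega)] at h1
  have hl : a + k + 2 * l ∉ insert (a + k + 2 * l + 1)
      (Finset.Ico a (a + k) \ {a + k - 2 - 2 * j, a + k - 1 - 2 * j}) := by
    simp only [Finset.mem_insert, Finset.mem_sdiff, Finset.mem_Ico]
    omega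
  have hl' : a + k + 2 * l + 1 ∉
      Finset.Ico a (a + k) \ {a + k - 2 - 2 * j, a + k - 1 - 2 * j} := by
    simp only [Finset.mem_sdiff, Finset.mem_Ico]
    omega
  rw [pivots, Finset.sum_insert hl, Finset.sum_insert hl']
  omega

/-- The index sets of the admissible pairs `(j, l)` in `pivots`, together with `none`, when the
block is followed by `m` further positions. -/
def pivotIndices (k m : ℕ) : Finset (Option (ℕ × ℕ)) :=
  Finset.insertNone (Finset.range (k / 2) ×ˢ Finset.range (m / 2))

theorem mem_pivotIndices_some {k m j l : ℕ} :
    some (j, l) ∈ pivotIndices k m ↔ 2 * j + 2 ≤ k ∧ 2 * l + 2 ≤ m := by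
  simp only [pivotIndices, Finset.some_mem_insertNone, Finset.mem_product, Finset.mem_range]
  omega

theorem card_pivots {a k m : ℕ} {o : Option (ℕ × ℕ)} (ho : o ∈ pivotIndices k m) :
    (pivots a k o).card = k := by
  rcases o with _ | ⟨j, l⟩
  · simp [pivots]
  · have h := sum_pivots_some (a := a) (l := l) (mem_pivotIndices_some.1 ho).1 fun _ => 1
    simp only [Finset.sum_const, smul_eq_mul, mul_one, Nat.card_Ico] at h
    omega

theorem le_of_mem_pivots {a k c : ℕ} {o : Option (ℕ × ℕ)} (hc : c ∈ pivots a k o) : a ≤ c := by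
  rcases o with _ | ⟨j, l⟩
  · exact (mem_pivots_none.1 hc).1
  · have := mem_pivots_some.1 hc
    omega

theorem lt_of_mem_pivots {a k m c : ℕ} {o : Option (ℕ × ℕ)} (ho : o ∈ pivotIndices k m)
    (hc : c ∈ pivots a k o) : c < a + k + m := by
  rcases o with _ | ⟨j, l⟩
  · have := mem_pivots_none.1 hc
    omega
  · have := mem_pivots_some.1 hc
    have := mem_pivotIndices_some.1 ho
    omega

/-- Two pivot sets in the same block differ in a removed pair or in an added pair. -/
theorem exists_pair_mem_pivots_of_ne {a k m : ℕ} {o o' : Option (ℕ × ℕ)}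
    (ho : o ∈ pivotIndices k m) (ho' : o' ∈ pivotIndices k m) (hne : o ≠ o') :
    ∃ x y, x ≠ y ∧ (x ∈ pivots a k o ∧ x ∉ pivots a k o') ∧
      (y ∈ pivots a k o ∧ y ∉ pivots a k o') := by
  rcases o with _ | ⟨j, l⟩ <;> rcases o' with _ | ⟨j', l'⟩
  · exact absurd rfl hne
  · have := mem_pivotIndices_some.1 ho'
    refine ⟨a + k - 2 - 2 * j', a + k - 1 - 2 * j', ?_⟩
    simp only [mem_pivots_none, mem_pivots_some]
    omega
  · refine ⟨a + k + 2 * l, a + k + 2 * l + 1, ?_⟩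
    simp only [mem_pivots_none, mem_pivots_some, true_or, or_true, true_and]
    omega
  · have h := mem_pivotIndices_some.1 ho
    have h' := mem_pivotIndices_some.1 ho'
    by_cases hj : j = j'
    · have hl : l ≠ l' := fun hl => hne (by rw [hj, hl])
      refine ⟨a + k + 2 * l, a + k + 2 * l + 1, ?_⟩
      simp only [mem_pivots_some, true_or, or_true, true_and]
      omega
    · refine ⟨a + k - 2 - 2 * j', a + k - 1 - 2 * j', ?_⟩
      simp only [mem_pivots_some]
      omega

/-- At least `k - 2 ≥ 2` pivots lie in the block itself, to the left of every later block. -/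
theorem exists_pair_mem_pivots_lt {a k m : ℕ} (hk : 4 ≤ k) {o : Option (ℕ × ℕ)}
    (ho : o ∈ pivotIndices k m) :
    ∃ x y, x ≠ y ∧ (x ∈ pivots a k o ∧ x < a + k) ∧ (y ∈ pivots a k o ∧ y < a + k) := by
  rcases o with _ | ⟨j, l⟩
  · refine ⟨a, a + 1, ?_⟩
    simp only [mem_pivots_none]
    omega
  · have h := mem_pivotIndices_some.1 ho
    rcases Nat.eq_zero_or_pos j with hj | hj
    · refine ⟨a, a + 1, ?_⟩
      simp only [mem_pivots_some]
      omega
    · refine ⟨a + k - 2, a + k - 1, ?_⟩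
      simp only [mem_pivots_some]
      omega

theorem card_inter_add_two_le {α : Type*} [DecidableEq α] {S R : Finset α} {x y : α} (hxy : x ≠ y)
    (hx : x ∈ S ∧ x ∉ R) (hy : y ∈ S ∧ y ∉ R) : (S ∩ R).card + 2 ≤ S.card := by
  have h1 : ({x, y} : Finset α) ⊆ S \ R := by
    intro c hc
    simp only [Finset.mem_insert, Finset.mem_singleton] at hc
    rw [Finset.mem_sdiff]
    rcases hc with rfl | rfl
    exacts [hx, hy]
  have h2 := Finset.card_le_card h1
  rw [Finset.card_pair hxy] at h2
  have h3 := Finset.card_inter_add_card_sdiff S R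
  omega

theorem pivots_none_inter_some_card {a k : ℕ} (hk : 2 ≤ k) :
    (pivots a k none ∩ pivots a k (some (0, 0))).card + 2 = k := by
  have h : pivots a k none ∩ pivots a k (some (0, 0)) = Finset.Ico a (a + k - 2) := by
    ext c
    rw [Finset.mem_inter, mem_pivots_none, mem_pivots_some, Finset.mem_Ico]
    omega
  rw [h, Nat.card_Ico]
  omega

/-- The columns, numbered from `0` to `n - 1`, whose numbers lie in `S`. -/
def columns (n : ℕ) (S : Finset ℕ) : Finset (Fin n) := Finset.univ.filter fun c => (c : ℕ) ∈ S

theorem mem_columns {n : ℕ} {S : Finset ℕ} {c : Fin n} : c ∈ columns n S ↔ (c : ℕ) ∈ S := by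
  simp [columns]

theorem sum_columns {n : ℕ} {S : Finset ℕ} (hS : ∀ c ∈ S, c < n) (f : ℕ → ℕ) :
    ∑ p ∈ columns n S, f p = ∑ p ∈ S, f p := by
  refine Finset.sum_bij (fun p _ => (p : ℕ)) (fun p hp => mem_columns.1 hp)
    (fun p _ r _ h => Fin.ext h) (fun c hc => ⟨⟨c, hS c hc⟩, mem_columns.2 hc, rfl⟩)
    fun _ _ => rfl

theorem card_columns {n : ℕ} {S : Finset ℕ} (hS : ∀ c ∈ S, c < n) :
    (columns n S).card = S.card := by
  simpa using sum_columns hS fun _ => 1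

theorem columns_inter (n : ℕ) (S R : Finset ℕ) :
    columns n S ∩ columns n R = columns n (S ∩ R) := by
  ext c
  simp [mem_columns]

/-- The columns from `a` on that are not in `S`. -/
def nonpivots (n a : ℕ) (S : Finset ℕ) : Finset (Fin n) := columns n (Finset.Ico a n \ S)

theorem mem_nonpivots {n a : ℕ} {S : Finset ℕ} {c : Fin n} :
    c ∈ nonpivots n a S ↔ a ≤ (c : ℕ) ∧ (c : ℕ) ∉ S := by
  simp [nonpivots, mem_columns]

theorem disjoint_nonpivots (n a : ℕ) (S : Finset ℕ) : Disjoint (columns n S) (nonpivots n a S) :=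
  Finset.disjoint_left.2 fun _ hc hc' => (mem_nonpivots.1 hc').2 (mem_columns.1 hc)

theorem card_nonpivots {n a k m : ℕ} {o : Option (ℕ × ℕ)} (hn : n = a + k + m)
    (ho : o ∈ pivotIndices k m) : (nonpivots n a (pivots a k o)).card = m := by
  have hsub : pivots a k o ⊆ Finset.Ico a n := fun c hc =>
    Finset.mem_Ico.2 ⟨le_of_mem_pivots hc, hn ▸ lt_of_mem_pivots ho hc⟩
  rw [nonpivots, card_columns (fun c hc => (Finset.mem_Ico.1 (Finset.mem_sdiff.1 hc).1).2),
    Finset.card_sdiff_of_subset hsub, Nat.card_Ico, card_pivots ho]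
  omega

theorem card_dots_pivots_add {n a k m : ℕ} {o : Option (ℕ × ℕ)} (hn : n = a + k + m)
    (ho : o ∈ pivotIndices k m) :
    2 * (dots (columns n (pivots a k o)) (nonpivots n a (pivots a k o))).card + k * k +
      2 * ∑ p ∈ pivots a k o, (p + 1) = 2 * (k * n) + k := by
  have hlt : ∀ c ∈ pivots a k o, c < n := fun c hc => hn ▸ lt_of_mem_pivots ho hc
  have h1 := card_dots_add (disjoint_nonpivots n a (pivots a k o)) fun p hp c hpc hc =>
    mem_nonpivots.2 ⟨(le_of_mem_pivots (mem_columns.1 hp)).trans hpc.le,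
      fun h => hc (mem_columns.2 h)⟩
  have h2 := two_mul_card_dots_self (columns n (pivots a k o))
  rw [sum_columns hlt fun p => p + 1, card_columns hlt, card_pivots ho] at h1
  rw [card_columns hlt, card_pivots ho] at h2
  omega

theorem two_mul_sum_Ico (a k : ℕ) :
    2 * ∑ p ∈ Finset.Ico a (a + k), (p + 1) = k * (2 * a + k + 1) := by
  induction k with
  | zero => simp
  | succ k ih =>
    rw [← add_assoc, Finset.sum_Ico_succ_top (by omega), mul_add, ih]
    ring

theorem card_dots_pivots_none {n a k m : ℕ} (hn : n = a + k + m) :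
    (dots (columns n (pivots a k none)) (nonpivots n a (pivots a k none))).card = k * m := by
  have h1 := card_dots_pivots_add hn (Finset.none_mem_insertNone : none ∈ pivotIndices k m)
  have h2 := two_mul_sum_Ico a k
  rw [show pivots a k none = Finset.Ico a (a + k) from rfl] at h1 ⊢
  rw [h2, hn] at h1
  rw [hn]
  nlinarith

theorem card_dots_pivots_some {n a k m j l : ℕ} (hn : n = a + k + m)
    (h : some (j, l) ∈ pivotIndices k m) :
    (dots (columns n (pivots a k (some (j, l)))) (nonpivots n a (pivots a k (some (j, l))))).card +
      (4 + 4 * j + 4 * l) = k * m := by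
  have hjl := mem_pivotIndices_some.1 h
  have h1 := card_dots_pivots_add hn h
  have h2 := two_mul_sum_Ico a k
  have h3 := sum_pivots_some (a := a) (l := l) hjl.1 fun p => p + 1
  have h4 : k * n = k * a + k * k + k * m := by rw [hn]; ring
  have h5 : k * (2 * a + k + 1) = 2 * (k * a) + k * k + k := by ring
  omega

/-! ### Comparison with the closed formula -/

/-- The bound `r ≤ 2 * J` makes the tail `q ^ (-4 * J)` of the series at most `q ^ (-2 * r)`; for
`J = k / 2`, `r = k - 2` it holds for either parity of `k`. -/
theorem le_geom_sum_inv {q : ℝ} (hq : 1 < q) {r J : ℕ} (h : r ≤ 2 * J) :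
    (q ^ (2 * r) - 1) / (q ^ 4 - 1) * (q ^ 4 / q ^ (2 * r)) ≤
      ∑ j ∈ Finset.range J, (q ^ (4 * j))⁻¹ := by
  have h4 : 1 < q ^ 4 := one_lt_pow₀ hq (by norm_num)
  have hr : 0 < q ^ (2 * r) := by positivity
  have hsum : (∑ j ∈ Finset.range J, (q ^ (4 * j))⁻¹) * (q ^ 4 - 1) =
      q ^ 4 * (1 - (q ^ (4 * J))⁻¹) := by
    have h1 := mul_neg_geom_sum (q ^ 4)⁻¹ J
    simp only [inv_pow, ← pow_mul] at h1
    rw [← h1]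
    field_simp
  have hle : (q ^ (4 * J))⁻¹ ≤ (q ^ (2 * r))⁻¹ :=
    inv_anti₀ hr (pow_le_pow_right₀ hq.le (by omega))
  refine le_of_mul_le_mul_right ?_ (sub_pos.2 h4)
  rw [hsum]
  have h5 : (q ^ (2 * r) - 1) / (q ^ 4 - 1) * (q ^ 4 / q ^ (2 * r)) * (q ^ 4 - 1) =
      q ^ 4 * (1 - (q ^ (2 * r))⁻¹) := by
    have : q ^ 4 - 1 ≠ 0 := (sub_pos.2 h4).ne'
    field_simp
  rw [h5]
  gcongr

theorem formula_le_sum_pivotIndices {q : ℝ} (hq : 1 < q) {k m : ℕ} (hk : 3 ≤ k) (hm : 2 ≤ m)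
    {D : Option (ℕ × ℕ) → ℕ} (hnone : D none = k * m)
    (hsome : ∀ j l, some (j, l) ∈ pivotIndices k m →
      D (some (j, l)) + (4 + 4 * j + 4 * l) = k * m) :
    q ^ ((k - 1) * m) + (q ^ (2 * (k - 2)) - 1) * (q ^ (2 * (m - 1)) - 1) / (q ^ 4 - 1) ^ 2 *
        q ^ ((k - 3) * (m - 2) + 4) ≤ ∑ o ∈ pivotIndices k m, q ^ D o / q ^ m := by
  have hq0 : 0 < q := one_pos.trans hq
  have h4 : q ^ 4 - 1 ≠ 0 := (sub_pos.2 (one_lt_pow₀ hq (by norm_num))).ne'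
  have hkm : k * m = (k - 1) * m + m := by
    obtain ⟨k, rfl⟩ := Nat.exists_eq_add_of_le hk
    simp only [show 3 + k - 1 = k + 2 by omega]
    ring
  rw [pivotIndices, Finset.sum_insertNone, hnone]
  have hfirst : q ^ (k * m) / q ^ m = q ^ ((k - 1) * m) := by
    rw [hkm, pow_add]
    field_simp
  have hrest : ∑ x ∈ Finset.range (k / 2) ×ˢ Finset.range (m / 2), q ^ D (some x) / q ^ m =
      q ^ ((k - 1) * m) / q ^ 4 * ((∑ j ∈ Finset.range (k / 2), (q ^ (4 * j))⁻¹) *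
        ∑ l ∈ Finset.range (m / 2), (q ^ (4 * l))⁻¹) := by
    rw [Finset.sum_mul_sum, ← Finset.sum_product', Finset.mul_sum]
    refine Finset.sum_congr rfl fun x hx => ?_
    have h := hsome x.1 x.2 (Finset.some_mem_insertNone.2 hx)
    have hpow : q ^ D (some x) * (q ^ 4 * q ^ (4 * x.1) * q ^ (4 * x.2)) =
        q ^ ((k - 1) * m) * q ^ m := by
      rw [← pow_add, ← pow_add, ← pow_add, ← pow_add, ← hkm, ← h]
    rw [div_eq_iff (by positivity)]
    field_simp
    linear_combination hpow
  rw [hfirst, hrest]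
  have hA := le_geom_sum_inv hq (show k - 2 ≤ 2 * (k / 2) by omega)
  have hB := le_geom_sum_inv hq (show m - 1 ≤ 2 * (m / 2) by omega)
  have hB0 : 0 ≤ (q ^ (2 * (m - 1)) - 1) / (q ^ 4 - 1) * (q ^ 4 / q ^ (2 * (m - 1))) :=
    mul_nonneg (div_nonneg (sub_nonneg.2 (one_le_pow₀ hq.le)) (sub_nonneg.2 (one_le_pow₀ hq.le)))
      (by positivity)
  have hAB := mul_le_mul hA hB hB0 (Finset.sum_nonneg fun j _ => by positivity)
  have hexp : q ^ ((k - 3) * (m - 2) + 4) * (q ^ (2 * (k - 2)) * q ^ (2 * (m - 1))) =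
      q ^ ((k - 1) * m) * q ^ 4 := by
    rw [← pow_add, ← pow_add, ← pow_add]
    congr 1
    obtain ⟨k, rfl⟩ := Nat.exists_eq_add_of_le hk
    obtain ⟨m, rfl⟩ := Nat.exists_eq_add_of_le hm
    simp only [show 3 + k - 3 = k by omega, show 2 + m - 2 = m by omega,
      show 3 + k - 2 = k + 1 by omega, show 2 + m - 1 = m + 1 by omega,
      show 3 + k - 1 = k + 2 by omega]
    ring
  refine add_le_add le_rfl ?_
  calc _ = q ^ ((k - 1) * m) / q ^ 4 *
        ((q ^ (2 * (k - 2)) - 1) / (q ^ 4 - 1) * (q ^ 4 / q ^ (2 * (k - 2))) *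
          ((q ^ (2 * (m - 1)) - 1) / (q ^ 4 - 1) * (q ^ 4 / q ^ (2 * (m - 1))))) := by
        have hX : q ^ ((k - 3) * (m - 2) + 4) =
            q ^ ((k - 1) * m) * q ^ 4 / (q ^ (2 * (k - 2)) * q ^ (2 * (m - 1))) :=
          eq_div_of_mul_eq (by positivity) hexp
        rw [hX]
        field_simp
    _ ≤ _ := by gcongr

end GrassmannCode

open GrassmannCode in
theorem mainTheorem5 {F : Type*} [Field F] [Fintype F] (q : ℕ) (hq : Fintype.card F = q)
    (n k : ℕ) (hk : 4 ≤ k) (hn : 2 * k + 2 ≤ n) :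
    ∑ i ∈ Finset.Icc 1 ((n - 2) / k - 1),
        ((q : ℝ) ^ ((k - 1) * (n - i * k)) +
          ((q : ℝ) ^ (2 * (k - 2)) - 1) * ((q : ℝ) ^ (2 * (n - i * k - 1)) - 1) /
              ((q : ℝ) ^ 4 - 1) ^ 2 *
            (q : ℝ) ^ ((k - 3) * (n - i * k - 2) + 4)) ≤
      (GrassmannCode.maxCodeSize F n 2 k : ℝ) := by
  classical
  subst hq
  have hq1 : (1 : ℝ) < Fintype.card F := by exact_mod_cast Fintype.one_lt_card
  -- In the range of summation at least `k + 2` columns remain to the right of block `i`.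
  have hblock : ∀ i ∈ Finset.Icc 1 ((n - 2) / k - 1),
      n = (i - 1) * k + k + (n - i * k) ∧ k + 2 ≤ n - i * k := by
    intro i hi
    rw [Finset.mem_Icc] at hi
    have h1 : (i + 1) * k ≤ n - 2 :=
      (Nat.mul_le_mul_right k (by omega)).trans (Nat.div_mul_le_self (n - 2) k)
    have h2 : (i - 1) * k + k = i * k := by
      obtain ⟨i, rfl⟩ := Nat.exists_eq_add_of_le hi.1
      rw [Nat.add_sub_cancel_left]
      ring
    rw [add_mul, one_mul] at h1
    omega
  let T : Finset (Σ _ : ℕ, Option (ℕ × ℕ)) :=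
    (Finset.Icc 1 ((n - 2) / k - 1)).sigma fun i => pivotIndices k (n - i * k)
  let S : (Σ _ : ℕ, Option (ℕ × ℕ)) → Finset ℕ := fun t => pivots ((t.1 - 1) * k) k t.2
  have hS : ∀ t ∈ T, ∀ c ∈ S t, c < n := by
    intro t ht c hc
    obtain ⟨h1, h2⟩ := Finset.mem_sigma.1 ht
    exact (lt_of_mem_pivots h2 hc).trans_eq (hblock _ h1).1.symm
  have hScard : ∀ t ∈ T, (S t).card = k := fun t ht => card_pivots (Finset.mem_sigma.1 ht).2
  -- The pivots of a later block all lie to the right of the present one.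
  have hfar : ∀ s ∈ T, ∀ t ∈ T, s.1 < t.1 → (S s ∩ S t).card + 2 ≤ k := by
    intro s hs t ht hst
    obtain ⟨x, y, hxy, ⟨hx, hx'⟩, ⟨hy, hy'⟩⟩ :=
      exists_pair_mem_pivots_lt (a := (s.1 - 1) * k) hk (Finset.mem_sigma.1 hs).2
    have h1 : 1 ≤ s.1 := (Finset.mem_Icc.1 (Finset.mem_sigma.1 hs).1).1
    have h2 : (s.1 - 1) * k + k ≤ (t.1 - 1) * k := by
      calc (s.1 - 1) * k + k = (s.1 - 1 + 1) * k := by ring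
        _ ≤ _ := Nat.mul_le_mul_right k (by omega)
    have hnot : ∀ z, z < (s.1 - 1) * k + k → z ∉ S t := fun z hz hzt =>
      absurd (le_of_mem_pivots hzt) (by omega)
    exact (card_inter_add_two_le hxy ⟨hx, hnot x hx'⟩ ⟨hy, hnot y hy'⟩).trans_eq (hScard s hs)
  have hT : ∀ s ∈ T, ∀ t ∈ T, s ≠ t → (S s ∩ S t).card + 2 ≤ k := by
    intro s hs t ht hst
    rcases lt_trichotomy s.1 t.1 with h | h | h
    · exact hfar s hs t ht h
    · obtain ⟨i, o⟩ := s
      obtain ⟨i', o'⟩ := t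
      obtain rfl : i = i' := h
      obtain ⟨x, y, hxy, hx, hy⟩ := exists_pair_mem_pivots_of_ne (a := (i - 1) * k)
        (Finset.mem_sigma.1 hs).2 (Finset.mem_sigma.1 ht).2 fun ho => hst (by
          change o = o' at ho
          rw [ho])
      exact (card_inter_add_two_le hxy hx hy).trans_eq (hScard _ hs)
    · rw [Finset.inter_comm]
      exact hfar t ht s hs h
  have hinter : ∀ s ∈ T, ∀ t, (columns n (S s) ∩ columns n (S t)).card = (S s ∩ S t).card := by
    intro s hs t
    rw [columns_inter]
    exact card_columns fun c hc => hS s hs c (Finset.mem_inter.1 hc).1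
  have hone : 1 ∈ Finset.Icc 1 ((n - 2) / k - 1) := by
    have : 2 ≤ (n - 2) / k := (Nat.le_div_iff_mul_le (by omega)).2 (by omega)
    rw [Finset.mem_Icc]
    omega
  have hmain := exists_multilevelCode (F := F) T (fun t => columns n (S t))
    (fun t => nonpivots n ((t.1 - 1) * k) (S t)) (fun t => n - t.1 * k)
    (fun t _ => disjoint_nonpivots n _ _) (by omega)
    (fun t ht => (card_columns (hS t ht)).trans (hScard t ht))
    (fun t ht => by have := (hblock _ (Finset.mem_sigma.1 ht).1).2; omega)
    (fun t ht => (card_nonpivots (hblock _ (Finset.mem_sigma.1 ht).1).1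
      (Finset.mem_sigma.1 ht).2).le)
    (fun s hs t ht hst => by rw [hinter s hs]; exact hT s hs t ht hst)
    ⟨⟨1, none⟩, Finset.mem_sigma.2 ⟨hone, Finset.none_mem_insertNone⟩, ⟨1, some (0, 0)⟩,
      Finset.mem_sigma.2 ⟨hone, mem_pivotIndices_some.2
        (by have := (hblock 1 hone).2; dsimp only; omega)⟩, by
      rw [hinter _ (Finset.mem_sigma.2 ⟨hone, Finset.none_mem_insertNone⟩)]
      exact pivots_none_inter_some_card (by omega)⟩
  refine le_trans ?_ hmain
  rw [Finset.sum_sigma]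
  refine Finset.sum_le_sum fun i hi => ?_
  have hb := hblock i hi
  exact formula_le_sum_pivotIndices hq1 (by omega) (by omega)
    (D := fun o => (dots (columns n (S ⟨i, o⟩)) (nonpivots n ((i - 1) * k) (S ⟨i, o⟩))).card)
    (card_dots_pivots_none hb.1) fun j l h => card_dots_pivots_some hb.1 h
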